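/- Let $d\ge 1$ and let $\mathbb{T}_d$ be the (infinite, if $d\ge 2$) $d$-regular tree with vertex set $V$ and a root $\circ$, and let $\chi$ be a finite set of colours. Let $f:[0,1]^{V}\to\chi$ be measurable with respect to the product Borel $\sigma$-algebra and invariant under root-preserving automorphisms, i.e. $f(\gamma\cdot\omega)=f(\omega)$ for every $\omega\in[0,1]^V$ and every $\gamma\in\mathrm{Aut}(\mathbb{T}_d)$ with $\gamma(\circ)=\circ$, where $(\gamma\cdot\omega)(v)=\omega(\gamma^{-1}v)$. Let $\mathbf{X}=(X(v))_{v\in V}$ be independent random variables, each uniformly distributed on $[0,1]$, and let $\Phi=(\Phi(v))_{v\in V}$ be the factor of iid (FIID) process $\Phi(v)=f(\gamma_{v\to\circ}\cdot\mathbf{X})$, where $\gamma_{v\to\circ}$ is any automorphism of $\mathbb{T}_d$ taking $v$ to $\circ$ (by invariance of $f$ the choice does not matter). For any directed edge $(u,v)$ of $\mathbb{T}_d$ (for instance an edge $(\circ,\circ')$ from the root), let $P_\Phi$ be the distribution of $(\Phi(u),\Phi(v))$ on $\chi\times\chi$, and let $\pi_\Phi$ be the distribution of $\Phi(\circ)$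 on $\chi$. Then $$\frac{d}{2}H(P_\Phi)-(d-1)H(\pi_\Phi)\ \ge\ 0,$$ where $H(\mu)=\sum_{x\in\mathrm{support}(\mu)}-\mu(x)\log\mu(x)$ denotes the entropy of a discrete probability distribution $\mu$. -/

import Mathlib

open MeasureTheory ProbabilityTheory

namespace FIID

/-- The action of a graph automorphism `γ` on labellings of the vertices:
`(γ · ω)(v) = ω (γ⁻¹ v)`. -/
def act {V L : Type*} {T : SimpleGraph V} (γ : T ≃g T) (ω : V → L) : V → L :=
  fun v => ω (γ.symm v)

/-- A random labelling of `V`: independent random variables `X v`, each uniform on `[0,1]`. -/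
structure IsRandomLabelling {V Ω : Type*} [MeasurableSpace Ω] (μ : Measure Ω)
    (X : V → Ω → unitInterval) : Prop where
  measurable : ∀ v, Measurable (X v)
  indep : iIndepFun X μ
  uniform : ∀ v, μ.map (X v) = (volume : Measure unitInterval)

/-- A factor on the graph `T` rooted at `o`: a function `[0,1]^V → χ` that is measurable for the
product Borel σ-algebra and invariant under the automorphisms of `T` that fix `o`. -/
structure IsFactor {V χ : Type*} [MeasurableSpace χ] (T : SimpleGraph V) (o : V)
    (f : (V → unitInterval) → χ) : Prop where
  measurable : Measurable f
  invariant : ∀ γ : T ≃g T, γ o = o → ∀ ω, f (act γ ω) = f ω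

/-- `Φ` is a factor of iid process on the graph `T` rooted at `o`: for some random labelling `X`
and some factor `f`, one has `Φ(v) = f(γ · X)` for every automorphism `γ` taking `v` to `o`.
(By invariance of `f` the value `f(γ · X)` is the same for all these `γ`.) -/
def IsFIID {V χ Ω : Type*} [MeasurableSpace χ] [MeasurableSpace Ω] (T : SimpleGraph V) (o : V)
    (μ : Measure Ω) (Φ : V → Ω → χ) : Prop :=
  ∃ (X : V → Ω → unitInterval) (f : (V → unitInterval) → χ),
    IsRandomLabelling μ X ∧ IsFactor T o f ∧
      ∀ (v : V) (γ : T ≃g T), γ v = o → ∀ a : Ω, Φ v a = f (act γ (fun u => X u a))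

/-- The entropy `H(ν) = ∑ₓ - ν(x) log ν(x)` of a distribution on a finite set; the points outside
the support of `ν` contribute `0`. -/
noncomputable def entropy {α : Type*} [Fintype α] [MeasurableSpace α] (ν : Measure α) : ℝ :=
  ∑ x, Real.negMulLog (ν.real {x})

end FIID

/-! Fix a discretization of the labels into finitely many values, with entropy `h` per label, and
let `G S R` be the joint entropy of the discretized labels on `S` and of `Φ` on `R`. It is
submodular, and invariant under automorphisms because the labels are iid. Consider `d/2` times the
entropy of an edge ball together with `Φ` at both ends, minus `d - 1` times the entropy of a vertex
ball together with `Φ` at its centre.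

A ball of radius `n + 1` is covered by edge balls of radius `n` sharing the central ball, and two
adjacent balls of radius `n + 1` meet in an edge ball of radius `n`. Submodularity then shows that
this functional does not increase with the radius, and that at every radius it exceeds the bare
edge-vertex expression by at most `h` (`edge_vertex_le`). For the labels alone it equals `h`
exactly, by counting vertices (`ballCard_identity`, `rvEntropy_labels`).

Adding `Φ` to the labels cannot lower the edge entropy, and on a large ball with a fine
discretization it raises the vertex entropy by at most `ε`, since `Φ` at the root is a function of
all labels (`tendsto_rvEntropy_prod_sub`, from Lévy's upward theorem). The functional is thus at
least `h - (d - 1) ε`; the two occurrences of `h` cancel and `ε` tends to `0`. -/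

namespace FIID

/-! ### Balls in regular trees and their sizes -/

section Tree

open scoped Classical

variable {V : Type*} {T : SimpleGraph V}

/-- In a tree, the neighbour of `u` that is closer to `x` is unique. -/
lemma eq_of_adj_of_dist_lt (hT : T.IsTree) {x u w w' : V} (hw : T.Adj u w) (hw' : T.Adj u w')
    (h : T.dist x w < T.dist x u) (h' : T.dist x w' < T.dist x u) : w = w' := by
  -- Stepping to a closer neighbour and following a geodesic gives a path from `u` to `x`; such a
  -- path is unique, hence so is its second vertex.
  have key : ∀ z (hz : T.Adj u z), T.dist x z < T.dist x u →
      ∃ q : T.Walk z x, (SimpleGraph.Walk.cons hz q).IsPath := by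
    intro z hz hlt
    obtain ⟨q, hq⟩ := hT.connected.exists_walk_length_eq_dist z x
    refine ⟨q, SimpleGraph.Walk.isPath_of_length_eq_dist _ ?_⟩
    have h1 := SimpleGraph.dist_le (SimpleGraph.Walk.cons hz q)
    rw [SimpleGraph.Walk.length_cons, hq] at h1 ⊢
    rw [SimpleGraph.dist_comm (u := z)] at h1 ⊢
    rw [SimpleGraph.dist_comm (u := u)] at h1 ⊢
    omega
  obtain ⟨q, hq⟩ := key w hw h
  obtain ⟨q', hq'⟩ := key w' hw' h'
  have := congrArg (fun p : T.Path u x => p.1.snd) 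
    ((hT.isAcyclic.subsingleton_path u x).elim ⟨_, hq⟩ ⟨_, hq'⟩)
  simpa using this

lemma exists_adj_dist_lt (hT : T.IsTree) {x u : V} (hne : u ≠ x) :
    ∃ w, T.Adj u w ∧ T.dist x u = T.dist x w + 1 := by
  obtain ⟨p, hp⟩ := hT.connected.exists_walk_length_eq_dist u x
  cases p with
  | nil => exact absurd rfl hne
  | @cons _ w _ h q =>
    refine ⟨w, h, ?_⟩
    rw [SimpleGraph.Walk.length_cons] at hp
    have h1 := SimpleGraph.dist_le q
    have h2 := hT.dist_eq_dist_add_one_of_adj x h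
    rw [SimpleGraph.dist_comm (u := u)] at hp
    rw [SimpleGraph.dist_comm (u := w)] at h1
    omega

variable [T.LocallyFinite]

/-- The vertices at distance at most `n` from `u`. -/
noncomputable def ball (T : SimpleGraph V) [T.LocallyFinite] : ℕ → V → Finset V
  | 0, u => {u}
  | n + 1, u => ball T n u ∪ (T.neighborFinset u).biUnion (ball T n)

lemma ball_subset_succ (n : ℕ) (u : V) : ball T n u ⊆ ball T (n + 1) u :=
  Finset.subset_union_left

lemma ball_subset_succ_of_adj (n : ℕ) {u w : V} (h : T.Adj u w) :
    ball T n w ⊆ ball T (n + 1) u :=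
  (Finset.subset_biUnion_of_mem (ball T n) ((T.mem_neighborFinset u w).2 h)).trans
    Finset.subset_union_right

lemma mem_ball (hT : T.IsTree) {n : ℕ} {u x : V} : x ∈ ball T n u ↔ T.dist x u ≤ n := by
  induction n generalizing u with
  | zero =>
    simp [ball, hT.connected.dist_eq_zero_iff]
  | succ n ih =>
    simp only [ball, Finset.mem_union, Finset.mem_biUnion, SimpleGraph.mem_neighborFinset, ih]
    constructor
    · rintro (h | ⟨w, hw, h⟩)
      · omega
      · have := hT.dist_eq_dist_add_one_of_adj x hw
        omega
    · intro h
      by_cases hu : u = x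
      · subst hu; simp
      · obtain ⟨w, hw, h'⟩ := exists_adj_dist_lt hT hu
        exact Or.inr ⟨w, hw, by omega⟩

lemma ball_mono (u : V) : Monotone (fun n => ball T n u) :=
  monotone_nat_of_le_succ fun n => ball_subset_succ n u

lemma image_ball (γ : T ≃g T) (n : ℕ) (u : V) :
    (ball T n u).image γ = ball T n (γ u) := by
  induction n generalizing u with
  | zero => simp [ball]
  | succ n ih =>
    have hN : T.neighborFinset (γ u) = (T.neighborFinset u).image γ := by
      ext x
      simp only [SimpleGraph.mem_neighborFinset, Finset.mem_image]
      constructor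
      · intro h
        exact ⟨γ.symm x, by rw [← γ.map_adj_iff]; simpa using h, by simp⟩
      · rintro ⟨y, hy, rfl⟩
        exact γ.map_adj_iff.2 hy
    simp only [ball]
    rw [Finset.image_union, ih, hN, Finset.image_biUnion, Finset.biUnion_image]
    simp only [ih]

/-- The sizes of the ball of radius `n` around a vertex and around an edge of a `d`-regular tree. -/
noncomputable def ballCard (d : ℕ) : ℕ → ℝ × ℝ
  | 0 => (1, 2)
  | n + 1 =>
    let p := ballCard d n
    let b := p.1 + d * (p.2 - p.1)
    (b, 2 * b - p.2)

/-- Equality counterpart of `edge_vertex_le`: the recursion makes the increments of the two terms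
cancel, so the value at radius `0` persists. -/
lemma ballCard_identity (d n : ℕ) :
    (d : ℝ) / 2 * (ballCard d n).2 - (d - 1) * (ballCard d n).1 = 1 := by
  induction n with
  | zero => simp [ballCard]
  | succ n ih => simp only [ballCard]; linarith

lemma card_ball (hT : T.IsTree) {d : ℕ} (hd : T.IsRegularOfDegree d) (n : ℕ) :
    (∀ u, ((ball T n u).card : ℝ) = (ballCard d n).1) ∧
    ∀ u v, T.Adj u v → ((ball T n u ∪ ball T n v).card : ℝ) = (ballCard d n).2 := by
  induction n with
  | zero =>
    refine ⟨fun u => by simp [ball, ballCard], fun u v h => ?_⟩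
    have : ({u} ∪ {v} : Finset V).card = 2 := Finset.card_pair h.ne
    simp only [ball, ballCard, this]
    norm_num
  | succ n ih =>
    obtain ⟨ih1, ih2⟩ := ih
    have hb : ∀ u, ((ball T (n + 1) u).card : ℝ) = (ballCard d (n + 1)).1 := by
      intro u
      -- A vertex gained by passing from the ball of `u` to that of `w` is closer to `w` than to
      -- `u`, and only one neighbour of `u` can be closer.
      have hdisj : ∀ w ∈ T.neighborFinset u, ∀ w' ∈ T.neighborFinset u, w ≠ w' →
          Disjoint (ball T n w \ ball T n u) (ball T n w' \ ball T n u) := by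
        intro w hw w' hw' hne
        rw [SimpleGraph.mem_neighborFinset] at hw hw'
        rw [Finset.disjoint_left]
        intro x hx hx'
        simp only [Finset.mem_sdiff, mem_ball hT, not_le] at hx hx'
        exact hne (eq_of_adj_of_dist_lt hT (x := x) hw hw' (by omega) (by omega))
      have h1 : ball T (n + 1) u = ball T n u ∪
          (T.neighborFinset u).biUnion (fun w => ball T n w \ ball T n u) := by
        ext x
        simp only [ball, Finset.mem_union, Finset.mem_biUnion, Finset.mem_sdiff]
        by_cases hx : x ∈ ball T n u <;> simp [hx]
      have h2 : Disjoint (ball T n u)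
          ((T.neighborFinset u).biUnion (fun w => ball T n w \ ball T n u)) := by
        rw [Finset.disjoint_biUnion_right]
        exact fun w _ => Finset.disjoint_sdiff
      have h3 : ∀ w ∈ T.neighborFinset u, ((ball T n w \ ball T n u).card : ℝ)
          = (ballCard d n).2 - (ballCard d n).1 := by
        intro w hw
        rw [SimpleGraph.mem_neighborFinset] at hw
        rw [← ih2 u w hw, ← ih1 u, ← Finset.union_sdiff_self_eq_union,
          Finset.card_union_of_disjoint Finset.disjoint_sdiff]
        push_cast; ring
      rw [h1, Finset.card_union_of_disjoint h2, Finset.card_biUnion hdisj]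
      push_cast
      rw [Finset.sum_congr rfl h3, Finset.sum_const, SimpleGraph.card_neighborFinset_eq_degree,
        hd u, ih1 u, ballCard, nsmul_eq_mul]
    refine ⟨hb, fun u v huv => ?_⟩
    -- Distances from `x` to the two ends of an edge differ by exactly one.
    have hinter : ball T (n + 1) u ∩ ball T (n + 1) v = ball T n u ∪ ball T n v := by
      ext x
      simp only [Finset.mem_inter, Finset.mem_union, mem_ball hT]
      have := hT.dist_eq_dist_add_one_of_adj x huv
      omega
    have := Finset.card_union_add_card_inter (ball T (n + 1) u) (ball T (n + 1) v)
    rw [hinter] at this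
    have h' : ((ball T (n + 1) u ∪ ball T (n + 1) v).card : ℝ)
        + ((ball T n u ∪ ball T n v).card : ℝ)
        = (ball T (n + 1) u).card + (ball T (n + 1) v).card := by exact_mod_cast this
    rw [hb, hb, ih2 u v huv] at h'
    have h4 : (ballCard d (n + 1)).2 = 2 * (ballCard d (n + 1)).1 - (ballCard d n).2 := rfl
    linarith

end Tree

/-! ### Transitivity of automorphisms on directed edges -/

section Automorphism

open scoped Classical

variable {V : Type*} {T : SimpleGraph V}

/-- The neighbour of `x` towards the root `o`, and `o` itself for `x = o`. -/
noncomputable def parent (T : SimpleGraph V) (o x : V) : V :=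
  if h : ∃ w, T.Adj x w ∧ T.dist o x = T.dist o w + 1 then h.choose else x

lemma parent_spec (hT : T.IsTree) {o x : V} (hx : x ≠ o) :
    T.Adj x (parent T o x) ∧ T.dist o x = T.dist o (parent T o x) + 1 := by
  have h := exists_adj_dist_lt hT hx
  rw [parent, dif_pos h]
  exact h.choose_spec

variable [T.LocallyFinite]

/-- The neighbours of `x` that are farther from the root `o` than `x`. -/
noncomputable def children (T : SimpleGraph V) [T.LocallyFinite] (o x : V) : Finset V :=
  (T.neighborFinset x).filter fun w => T.dist o x < T.dist o w

lemma mem_children {o x w : V} :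
    w ∈ children T o x ↔ T.Adj x w ∧ T.dist o x < T.dist o w := by
  simp [children]

lemma mem_children_iff_parent_eq (hT : T.IsTree) {o x w : V} :
    w ∈ children T o x ↔ w ≠ o ∧ parent T o w = x := by
  rw [mem_children]
  constructor
  · rintro ⟨h, hlt⟩
    have hw : w ≠ o := by rintro rfl; simp at hlt
    obtain ⟨h1, h2⟩ := parent_spec hT hw
    exact ⟨hw, eq_of_adj_of_dist_lt hT h1 h.symm (by omega) hlt⟩
  · rintro ⟨hw, rfl⟩
    obtain ⟨h1, h2⟩ := parent_spec hT hw
    exact ⟨h1.symm, by omega⟩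

lemma card_children (hT : T.IsTree) {d : ℕ} (hd : T.IsRegularOfDegree d) (o x : V) :
    (children T o x).card = if x = o then d else d - 1 := by
  split_ifs with h
  · subst h
    rw [← hd x, ← SimpleGraph.card_neighborFinset_eq_degree, children,
      Finset.filter_true_of_mem]
    intro w hw
    rw [SimpleGraph.mem_neighborFinset] at hw
    have := hT.connected.pos_dist_of_ne hw.ne
    simpa using this
  · obtain ⟨h1, h2⟩ := parent_spec hT h
    have : children T o x = (T.neighborFinset x).erase (parent T o x) := by
      ext w
      rw [mem_children, Finset.mem_erase, SimpleGraph.mem_neighborFinset]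
      constructor
      · rintro ⟨h3, h4⟩
        refine ⟨?_, h3⟩
        rintro rfl
        omega
      · rintro ⟨h3, h4⟩
        refine ⟨h4, ?_⟩
        by_contra hlt
        have := hT.dist_ne_of_adj o h4
        exact h3 (eq_of_adj_of_dist_lt hT (x := o) h4 h1 (by omega) (by omega))
    rw [this, Finset.card_erase_of_mem (by simpa using h1),
      SimpleGraph.card_neighborFinset_eq_degree, hd x]

lemma exists_bijOn_of_card_eq {s t : Finset V} (h : s.card = t.card) :
    ∃ f : V → V, Set.BijOn f s t := by
  let e := Finset.equivOfCardEq h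
  refine ⟨fun x => if hx : x ∈ s then e ⟨x, hx⟩ else x, ?_, ?_, ?_⟩
  · intro x hx
    have hx' : x ∈ s := hx
    simp only [dif_pos hx']
    exact (e ⟨x, hx'⟩).2
  · intro x hx y hy hxy
    have hx' : x ∈ s := hx
    have hy' : y ∈ s := hy
    simp only [dif_pos hx', dif_pos hy'] at hxy
    simpa using e.injective (Subtype.ext hxy)
  · intro y hy
    refine ⟨e.symm ⟨y, hy⟩, (e.symm ⟨y, hy⟩).2, ?_⟩
    simp

/-- The automorphism group of a regular tree acts transitively on directed edges. -/
theorem exists_iso_of_adj (hT : T.IsTree) {d : ℕ} (hd : T.IsRegularOfDegree d) {o p o' p' : V}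
    (hp : T.Adj o p) (hp' : T.Adj o' p') : ∃ γ : T ≃g T, γ o = o' ∧ γ p = p' := by
  -- A root has `d` children and any other vertex `d - 1`, so children can be matched only between
  -- two roots or two non-roots.
  have hσ : ∀ x y, ∃ f : V → V, (x = o ↔ y = o') →
      Set.BijOn f (children T o x) (children T o' y) := by
    intro x y
    by_cases h : x = o ↔ y = o'
    · obtain ⟨f, hf⟩ := exists_bijOn_of_card_eq (s := children T o x) (t := children T o' y)
        (by rw [card_children hT hd, card_children hT hd]; simp [h])
      exact ⟨f, fun _ => hf⟩
    · exact ⟨id, fun h' => absurd h' h⟩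
  choose σ₀ hσ₀ using hσ
  have hpc : p ∈ children T o o :=
    mem_children.2 ⟨hp, by simpa using hT.connected.pos_dist_of_ne hp.ne⟩
  have hpc' : p' ∈ children T o' o' :=
    mem_children.2 ⟨hp', by simpa using hT.connected.pos_dist_of_ne hp'.ne⟩
  obtain ⟨σ, hσ, hσp⟩ : ∃ σ : V → V → V → V, (∀ x y, (x = o ↔ y = o') →
      Set.BijOn (σ x y) (children T o x) (children T o' y)) ∧ σ o o' p = p' := by
    have hb := hσ₀ o o' (by simp)
    have hq : σ₀ o o' p ∈ children T o' o' := hb.mapsTo hpc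
    -- Correcting the matching at the roots by a transposition forces `p` to go to `p'`.
    let τ := Equiv.swap (σ₀ o o' p) p'
    have hτ : Set.BijOn τ (children T o' o') (children T o' o') := by
      refine ⟨fun z hz => ?_, τ.injective.injOn, fun z hz => ⟨τ z, ?_, Equiv.swap_apply_self _ _ z⟩⟩
      all_goals
        simp only [τ, Equiv.swap_apply_def]
        split_ifs <;> assumption
    refine ⟨fun x y => if x = o ∧ y = o' then τ ∘ σ₀ o o' else σ₀ x y, fun x y hxy => ?_, ?_⟩
    · by_cases h : x = o ∧ y = o'
      · simp only [if_pos h]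
        rw [h.1, h.2]
        exact hτ.comp hb
      · simp only [if_neg h]
        exact hσ₀ x y hxy
    · simp [τ]
  -- The map is built along the tree, the image of a vertex being chosen among the children of its
  -- parent's image; the natural number is the depth.
  let F : ℕ → V → V := fun n => Nat.rec (fun _ => o')
    (fun _ g v => σ (parent T o v) (g (parent T o v)) v) n
  let φ : V → V := fun v => F (T.dist o v) v
  have hφo : φ o = o' := by simp [φ, F]
  have hφ : ∀ v, v ≠ o → φ v = σ (parent T o v) (φ (parent T o v)) v := by
    intro v hv
    have h2 := (parent_spec hT hv).2
    simp only [φ]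
    rw [h2]
  have hdist : ∀ n v, T.dist o v = n → T.dist o' (φ v) = n := by
    intro n
    induction n with
    | zero =>
      intro v hv
      rw [hT.connected.dist_eq_zero_iff] at hv
      rw [← hv, hφo, SimpleGraph.dist_self]
    | succ n ih =>
      intro v hv
      have hvo : v ≠ o := by rintro rfl; simp at hv
      obtain ⟨h1, h2⟩ := parent_spec hT hvo
      have h3 := ih (parent T o v) (by omega)
      have hiff : parent T o v = o ↔ φ (parent T o v) = o' := by
        rw [eq_comm, ← hT.connected.dist_eq_zero_iff, eq_comm (b := o'),
          ← hT.connected.dist_eq_zero_iff]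
        omega
      have h4 := (hσ _ _ hiff).mapsTo ((mem_children_iff_parent_eq hT).2 ⟨hvo, rfl⟩)
      rw [← hφ v hvo] at h4
      have h5 := mem_children.1 (Finset.mem_coe.1 h4)
      have := hT.dist_eq_dist_add_one_of_adj o' h5.1
      omega
  have hdist' : ∀ v, T.dist o' (φ v) = T.dist o v := fun v => hdist _ v rfl
  have hroot : ∀ v, v = o ↔ φ v = o' := by
    intro v
    rw [eq_comm, ← hT.connected.dist_eq_zero_iff, eq_comm (b := o'),
      ← hT.connected.dist_eq_zero_iff, hdist']
  have hbij : ∀ v, Set.BijOn (σ v (φ v)) (children T o v) (children T o' (φ v)) :=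
    fun v => hσ _ _ (hroot v)
  have hpar : ∀ v, v ≠ o → parent T o' (φ v) = φ (parent T o v) := by
    intro v hv
    have h4 := (hbij (parent T o v)).mapsTo ((mem_children_iff_parent_eq hT).2 ⟨hv, rfl⟩)
    rw [← hφ v hv] at h4
    exact ((mem_children_iff_parent_eq hT).1 h4).2
  have hinj : ∀ n v w, T.dist o v = n → φ v = φ w → v = w := by
    intro n
    induction n with
    | zero =>
      intro v w hv h
      rw [hT.connected.dist_eq_zero_iff] at hv
      rw [← hv] at h ⊢
      exact ((hroot w).2 (by rw [← h, hφo])).symm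
    | succ n ih =>
      intro v w hv h
      have hvo : v ≠ o := by rintro rfl; simp at hv
      have hwo : w ≠ o := by rw [Ne, hroot, ← h, ← hroot]; exact hvo
      have h2 := (parent_spec hT hvo).2
      have h3 : parent T o v = parent T o w :=
        ih _ _ (by omega) (by rw [← hpar v hvo, ← hpar w hwo, h])
      have h4 := h
      rw [hφ v hvo, hφ w hwo, ← h3] at h4
      exact (hbij (parent T o v)).injOn ((mem_children_iff_parent_eq hT).2 ⟨hvo, rfl⟩)
        ((mem_children_iff_parent_eq hT).2 ⟨hwo, h3.symm⟩) h4
  have hsurj : ∀ n y, T.dist o' y = n → ∃ v, φ v = y := by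
    intro n
    induction n with
    | zero =>
      intro y hy
      rw [hT.connected.dist_eq_zero_iff] at hy
      exact ⟨o, by rw [hφo, hy]⟩
    | succ n ih =>
      intro y hy
      have hyo : y ≠ o' := by rintro rfl; simp at hy
      have h2 := (parent_spec hT hyo).2
      obtain ⟨x, hx⟩ := ih (parent T o' y) (by omega)
      obtain ⟨z, hz, hzy⟩ := (hbij x).surjOn
        ((mem_children_iff_parent_eq hT (w := y)).2 ⟨hyo, hx.symm⟩)
      obtain ⟨hz1, hz2⟩ := (mem_children_iff_parent_eq hT).1 hz
      exact ⟨z, by rw [hφ z hz1, hz2, hzy]⟩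
  have hinj' : Function.Injective φ := fun v w h => hinj _ v w rfl h
  let e : V ≃ V := Equiv.ofBijective φ ⟨hinj', fun y => hsurj _ y rfl⟩
  have hadj : ∀ r x y, T.Adj x y ↔
      (x ≠ r ∧ parent T r x = y) ∨ (y ≠ r ∧ parent T r y = x) := by
    intro r x y
    rw [← mem_children_iff_parent_eq hT, ← mem_children_iff_parent_eq hT, mem_children,
      mem_children, T.adj_comm y x, ← and_or_left]
    refine ⟨fun h => ⟨h, ?_⟩, And.left⟩
    have := hT.dist_ne_of_adj r h
    omega
  have hchild : ∀ x y, (φ x ≠ o' ∧ parent T o' (φ x) = φ y) ↔ (x ≠ o ∧ parent T o x = y) := by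
    intro x y
    rw [Ne, ← hroot]
    refine and_congr_right fun hx => ?_
    rw [hpar x hx, hinj'.eq_iff]
  refine ⟨⟨e, fun {x y} => ?_⟩, hφo, ?_⟩
  · change T.Adj (φ x) (φ y) ↔ T.Adj x y
    rw [hadj o', hadj o, hchild, hchild]
  · change φ p = p'
    have h1 := (mem_children_iff_parent_eq hT).1 hpc
    rw [hφ p h1.1, h1.2, hφo, hσp]

end Automorphism

/-! ### Entropy of finite-valued random variables -/

section Entropy

open Real (negMulLog)

/-- Subadditivity of entropy, for an unnormalized joint distribution. -/
lemma sum_negMulLog_add_le {α β : Type*} [Fintype α] [Fintype β] (p : α → β → ℝ)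
    (hp : ∀ a b, 0 ≤ p a b) :
    (∑ a, ∑ b, negMulLog (p a b)) + negMulLog (∑ a, ∑ b, p a b) ≤
      (∑ a, negMulLog (∑ b, p a b)) + ∑ b, negMulLog (∑ a, p a b) := by
  set P := ∑ a, ∑ b, p a b with hP
  set r : α → ℝ := fun a => ∑ b, p a b with hr
  set s : β → ℝ := fun b => ∑ a, p a b with hs
  have hr0 : ∀ a, 0 ≤ r a := fun a => Finset.sum_nonneg fun b _ => hp a b
  have hs0 : ∀ b, 0 ≤ s b := fun b => Finset.sum_nonneg fun a _ => hp a b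
  have hP0 : 0 ≤ P := Finset.sum_nonneg fun a _ => hr0 a
  have hpr : ∀ a b, p a b ≤ r a := fun a b =>
    Finset.single_le_sum (f := fun b => p a b) (fun b _ => hp a b) (Finset.mem_univ b)
  have hps : ∀ a b, p a b ≤ s b := fun a b =>
    Finset.single_le_sum (f := fun a => p a b) (fun a _ => hp a b) (Finset.mem_univ a)
  have hrP : ∀ a, r a ≤ P := fun a =>
    Finset.single_le_sum (f := r) (fun a _ => hr0 a) (Finset.mem_univ a)
  have hsumr : ∑ a, r a = P := rfl
  have hsums : ∑ b, s b = P := Finset.sum_comm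
  -- This is `log t ≤ t - 1` at `t = r a * s b / (p a b * P)`; summed over `a` and `b`, the left
  -- side vanishes.
  have hterm : ∀ a b, p a b - r a * s b / P ≤
      p a b * (Real.log (p a b) + Real.log P - Real.log (r a) - Real.log (s b)) := by
    intro a b
    rcases (hp a b).eq_or_lt with h | h
    · rw [← h]
      have : 0 ≤ r a * s b / P := div_nonneg (mul_nonneg (hr0 a) (hs0 b)) hP0
      linarith
    · have h1 : 0 < r a := h.trans_le (hpr a b)
      have h2 : 0 < s b := h.trans_le (hps a b)
      have h3 : 0 < P := h1.trans_le (hrP a)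
      have h4 := Real.log_le_sub_one_of_pos (x := r a * s b / (p a b * P)) (by positivity)
      rw [Real.log_div (by positivity) (by positivity), Real.log_mul h1.ne' h2.ne',
        Real.log_mul h.ne' h3.ne'] at h4
      have h5 : r a * s b / P = p a b * (r a * s b / (p a b * P)) := by
        field_simp
      rw [h5]
      nlinarith
  have hsum := Finset.sum_le_sum fun a (_ : a ∈ Finset.univ) =>
    Finset.sum_le_sum fun b (_ : b ∈ Finset.univ) => hterm a b
  have hleft : ∑ a, ∑ b, (p a b - r a * s b / P) = 0 := by
    simp only [Finset.sum_sub_distrib, ← Finset.sum_div, ← Finset.mul_sum, ← Finset.sum_mul]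
    rw [hsums, hsumr]
    rcases hP0.eq_or_lt with h | h
    · rw [← h]; simp
    · field_simp; ring
  have e1 : ∑ a, ∑ b, p a b * Real.log P = P * Real.log P := by
    simp only [← Finset.sum_mul]; rfl
  have e2 : ∑ a, ∑ b, p a b * Real.log (r a) = ∑ a, r a * Real.log (r a) := by
    simp only [← Finset.sum_mul]; rfl
  have e3 : ∑ a, ∑ b, p a b * Real.log (s b) = ∑ b, s b * Real.log (s b) := by
    rw [Finset.sum_comm]
    simp only [← Finset.sum_mul]; rfl
  rw [hleft] at hsum
  simp only [mul_add, mul_sub, Finset.sum_add_distrib, Finset.sum_sub_distrib] at hsum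
  rw [e1, e2, e3] at hsum
  simp only [negMulLog, neg_mul, Finset.sum_neg_distrib]
  linarith

variable {Ω α β γ δ : Type*} [MeasurableSpace Ω]

lemma exists_eq_comp {Y : Ω → α} {Z : Ω → β} (μ : Measure Ω) [IsProbabilityMeasure μ]
    (h : ∀ a b, Y a = Y b → Z a = Z b) : ∃ g : α → β, Z = g ∘ Y := by
  obtain ⟨a⟩ := μ.nonempty_of_neZero
  have : Nonempty β := ⟨Z a⟩
  exact (Function.factorsThrough_iff Z).1 fun a b => h a b

lemma measurableSet_preimage_prod {Y : Ω → α} {Z : Ω → β} (hY : ∀ y, MeasurableSet (Y ⁻¹' {y}))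
    (hZ : ∀ z, MeasurableSet (Z ⁻¹' {z})) (x : α × β) :
    MeasurableSet ((fun a => (Y a, Z a)) ⁻¹' {x}) := by
  have : (fun a => (Y a, Z a)) ⁻¹' {x} = Y ⁻¹' {x.1} ∩ Z ⁻¹' {x.2} := by
    ext a; simp [Prod.ext_iff]
  rw [this]
  exact (hY _).inter (hZ _)

variable [Fintype α]

/-- The entropy of a random variable with finitely many values. -/
noncomputable def rvEntropy (μ : Measure Ω) (Y : Ω → α) : ℝ :=
  ∑ y, negMulLog (μ.real (Y ⁻¹' {y}))

lemma entropy_map (μ : Measure Ω) [MeasurableSpace α] [MeasurableSingletonClass α] {Y : Ω → α}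
    (hY : Measurable Y) : entropy (μ.map Y) = rvEntropy μ Y := by
  refine Finset.sum_congr rfl fun y _ => ?_
  rw [measureReal_def, measureReal_def, Measure.map_apply hY (measurableSet_singleton y)]

variable {μ : Measure Ω} [IsProbabilityMeasure μ]

lemma measureReal_comp_preimage [DecidableEq β] {Y : Ω → α} (hY : ∀ y, MeasurableSet (Y ⁻¹' {y}))
    (g : α → β) (z : β) :
    μ.real ((g ∘ Y) ⁻¹' {z}) = ∑ y with g y = z, μ.real (Y ⁻¹' {y}) := by
  rw [← measureReal_biUnion_finset]
  · congr 1
    ext a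
    simp
  · intro y _ y' _ hne
    exact Disjoint.preimage _ (by simpa using hne)
  · exact fun y _ => hY y

lemma sum_measureReal_preimage {Y : Ω → α} (hY : ∀ y, MeasurableSet (Y ⁻¹' {y})) :
    ∑ y, μ.real (Y ⁻¹' {y}) = 1 := by
  classical
  have h : ((fun _ => ()) ∘ Y) ⁻¹' {()} = Set.univ := by ext; simp
  have := measureReal_comp_preimage (μ := μ) hY (fun _ => ()) ()
  rw [h, probReal_univ] at this
  simpa using this.symm

variable [Fintype β] [Fintype γ] [Fintype δ]

/-- Entropy decreases when passing to a function of a random variable. -/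
lemma rvEntropy_le {Y : Ω → α} {Z : Ω → β} (hY : ∀ y, MeasurableSet (Y ⁻¹' {y}))
    (h : ∀ a b, Y a = Y b → Z a = Z b) : rvEntropy μ Z ≤ rvEntropy μ Y := by
  classical
  obtain ⟨g, rfl⟩ := exists_eq_comp μ h
  set p : α → ℝ := fun y => μ.real (Y ⁻¹' {y})
  set q : β → ℝ := fun z => μ.real ((g ∘ Y) ⁻¹' {z})
  have hq : ∀ z, q z = ∑ y with g y = z, p y := measureReal_comp_preimage hY g
  -- Spreading the sum over the fibres of `g` allows a termwise comparison, as each `p y` is at most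
  -- the mass `q (g y)` of its fibre.
  have h1 : rvEntropy μ (g ∘ Y) = ∑ y, -(p y * Real.log (q (g y))) := by
    rw [rvEntropy, ← Finset.sum_fiberwise Finset.univ g]
    refine Finset.sum_congr rfl fun z _ => ?_
    rw [Finset.sum_congr rfl (g := fun y => -(p y * Real.log (q z)))
      (fun y hy => by rw [(Finset.mem_filter.1 hy).2])]
    rw [Finset.sum_neg_distrib, ← Finset.sum_mul, ← hq, negMulLog, neg_mul]
  rw [h1, rvEntropy]
  refine Finset.sum_le_sum fun y _ => ?_
  have hp0 : 0 ≤ p y := measureReal_nonneg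
  rw [negMulLog, neg_mul, neg_le_neg_iff]
  rcases hp0.eq_or_lt with h0 | h0
  · change p y * Real.log (p y) ≤ _
    rw [← h0]; simp
  · refine mul_le_mul_of_nonneg_left (Real.log_le_log h0 ?_) hp0
    rw [hq]
    exact Finset.single_le_sum (f := p) (fun _ _ => measureReal_nonneg)
      (by simp : y ∈ Finset.univ.filter fun y' => g y' = g y)

lemma rvEntropy_eq {Y : Ω → α} {Z : Ω → β} (hY : ∀ y, MeasurableSet (Y ⁻¹' {y}))
    (hZ : ∀ z, MeasurableSet (Z ⁻¹' {z}))
    (h : ∀ a b, Y a = Y b ↔ Z a = Z b) : rvEntropy μ Y = rvEntropy μ Z :=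
  le_antisymm (rvEntropy_le hZ fun a b => (h a b).2) (rvEntropy_le hY fun a b => (h a b).1)

/-- Unnormalized subadditivity holds on each slice `C = z`; summing over `z` gives the conditional
form without any conditional distributions. -/
lemma rvEntropy_prod_submodular {A : Ω → α} {B : Ω → β} {C : Ω → γ}
    (hA : ∀ y, MeasurableSet (A ⁻¹' {y})) (hB : ∀ y, MeasurableSet (B ⁻¹' {y}))
    (hC : ∀ y, MeasurableSet (C ⁻¹' {y})) :
    rvEntropy μ (fun a => ((A a, B a), C a)) + rvEntropy μ C ≤
      rvEntropy μ (fun a => (A a, C a)) + rvEntropy μ (fun a => (B a, C a)) := by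
  classical
  have hABC := measurableSet_preimage_prod (measurableSet_preimage_prod hA hB) hC
  let p : α → β → γ → ℝ := fun x y z => μ.real ((fun a => ((A a, B a), C a)) ⁻¹' {((x, y), z)})
  have hAC : ∀ x z, μ.real ((fun a => (A a, C a)) ⁻¹' {(x, z)}) = ∑ y, p x y z := by
    intro x z
    have := measureReal_comp_preimage (μ := μ) hABC (fun w => (w.1.1, w.2)) (x, z)
    refine this.trans ?_
    rw [Finset.sum_filter, Fintype.sum_prod_type, Fintype.sum_prod_type]
    simp [Prod.ext_iff, ite_and, p]
  have hBC : ∀ y z, μ.real ((fun a => (B a, C a)) ⁻¹' {(y, z)}) = ∑ x, p x y z := by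
    intro y z
    have := measureReal_comp_preimage (μ := μ) hABC (fun w => (w.1.2, w.2)) (y, z)
    refine this.trans ?_
    rw [Finset.sum_filter, Fintype.sum_prod_type, Fintype.sum_prod_type]
    simp [Prod.ext_iff, ite_and, p]
  have hC' : ∀ z, μ.real (C ⁻¹' {z}) = ∑ x, ∑ y, p x y z := by
    intro z
    have := measureReal_comp_preimage (μ := μ) hABC (fun w => w.2) z
    refine this.trans ?_
    rw [Finset.sum_filter, Fintype.sum_prod_type, Fintype.sum_prod_type]
    simp [p]
  have key := Finset.sum_le_sum fun z (_ : z ∈ Finset.univ) =>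
    sum_negMulLog_add_le (fun x y => p x y z) (fun _ _ => measureReal_nonneg)
  simp only [Finset.sum_add_distrib] at key
  simp only [rvEntropy, Fintype.sum_prod_type_right, hAC, hBC, hC']
  refine le_trans (le_of_eq ?_) key
  congr 1
  exact Finset.sum_congr rfl fun z _ => Finset.sum_comm

/-- Submodularity of entropy: if `D` is a function of `(A, B)` and `C` is both a function of `A` and
a function of `B`, then `H(D) + H(C) ≤ H(A) + H(B)`. -/
lemma rvEntropy_submodular {A : Ω → α} {B : Ω → β} {C : Ω → γ} {D : Ω → δ}
    (hA : ∀ y, MeasurableSet (A ⁻¹' {y})) (hB : ∀ y, MeasurableSet (B ⁻¹' {y}))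
    (hC : ∀ y, MeasurableSet (C ⁻¹' {y}))
    (hD : ∀ a b, A a = A b → B a = B b → D a = D b)
    (hCA : ∀ a b, A a = A b → C a = C b) (hCB : ∀ a b, B a = B b → C a = C b) :
    rvEntropy μ D + rvEntropy μ C ≤ rvEntropy μ A + rvEntropy μ B := by
  have h1 := rvEntropy_prod_submodular (μ := μ) hA hB hC
  have h2 : rvEntropy μ D ≤ rvEntropy μ (fun a => ((A a, B a), C a)) :=
    rvEntropy_le (measurableSet_preimage_prod (measurableSet_preimage_prod hA hB) hC)
      fun a b h => by
        simp only [Prod.mk.injEq] at h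
        exact hD a b h.1.1 h.1.2
  have h3 : rvEntropy μ (fun a => (A a, C a)) ≤ rvEntropy μ A :=
    rvEntropy_le hA fun a b h => by simp [h, hCA a b h]
  have h4 : rvEntropy μ (fun a => (B a, C a)) ≤ rvEntropy μ B :=
    rvEntropy_le hB fun a b h => by simp [h, hCB a b h]
  linarith

/-- Entropy is additive for a pair of independent random variables. -/
lemma rvEntropy_prod_of_indep {A : Ω → α} {B : Ω → β}
    (hA : ∀ y, MeasurableSet (A ⁻¹' {y})) (hB : ∀ y, MeasurableSet (B ⁻¹' {y}))
    (h : ∀ x y, μ.real (A ⁻¹' {x} ∩ B ⁻¹' {y}) = μ.real (A ⁻¹' {x}) * μ.real (B ⁻¹' {y})) :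
    rvEntropy μ (fun a => (A a, B a)) = rvEntropy μ A + rvEntropy μ B := by
  have hp : ∀ x y, μ.real ((fun a => (A a, B a)) ⁻¹' {(x, y)}) =
      μ.real (A ⁻¹' {x}) * μ.real (B ⁻¹' {y}) := by
    intro x y
    rw [← h]
    congr 1
    ext a; simp
  simp only [rvEntropy, Fintype.sum_prod_type, hp, Real.negMulLog_mul, Finset.sum_add_distrib,
    ← Finset.sum_mul, ← Finset.mul_sum, sum_measureReal_preimage hA, sum_measureReal_preimage hB, one_mul]

end Entropy

/-! ### Submodular functions on balls of the tree -/

section Submodular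

open scoped Classical

variable {V : Type*} {T : SimpleGraph V} [T.LocallyFinite]

/-- Submodularity and monotonicity for functions of two finite sets. -/
def IsSubmodular (G : Finset V → Finset V → ℝ) : Prop :=
  ∀ ⦃S S₁ S₂ S₀ R R₁ R₂ R₀ : Finset V⦄, S ⊆ S₁ ∪ S₂ → R ⊆ R₁ ∪ R₂ → S₀ ⊆ S₁ → S₀ ⊆ S₂ →
    R₀ ⊆ R₁ → R₀ ⊆ R₂ → G S R + G S₀ R₀ ≤ G S₁ R₁ + G S₂ R₂

variable {G : Finset V → Finset V → ℝ} {a c : ℕ → ℝ}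

/-- `IsSubmodular` asks only for inclusion in the unions, so all other sets can be taken equal to
`S'` and `R'`. -/
lemma IsSubmodular.mono (hG : IsSubmodular G) {S S' R R' : Finset V} (hS : S ⊆ S') (hR : R ⊆ R') :
    G S R ≤ G S' R' := by
  have := hG (S := S) (S₁ := S') (S₂ := S') (S₀ := S') (R := R) (R₁ := R') (R₂ := R') (R₀ := R')
    (by simpa) (by simpa) le_rfl le_rfl le_rfl le_rfl
  linarith

/-- The neighbours' balls are attached one at a time, each costing at most the increment `c n - a n`
over the common part `ball T n u`. -/
lemma ball_succ_le (hG : IsSubmodular G) {d : ℕ} (hd : T.IsRegularOfDegree d)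
    (ha : ∀ n u, G (ball T n u) {u} = a n)
    (hc : ∀ n u v, T.Adj u v → G (ball T n u ∪ ball T n v) {u} = c n) (n : ℕ) (u : V) :
    a (n + 1) ≤ a n + d * (c n - a n) := by
  have key : ∀ N : Finset V, N ⊆ T.neighborFinset u →
      G (ball T n u ∪ N.biUnion (ball T n)) {u} ≤ a n + N.card * (c n - a n) := by
    intro N
    induction N using Finset.induction_on with
    | empty => intro _; simp [ha]
    | insert w N hw ih =>
      intro hN
      have h1 := ih ((Finset.subset_insert w N).trans hN)
      have hadj : T.Adj u w := by simpa using hN (Finset.mem_insert_self w N)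
      have h2 := hG (S := ball T n u ∪ (insert w N).biUnion (ball T n))
        (S₁ := ball T n u ∪ N.biUnion (ball T n)) (S₂ := ball T n u ∪ ball T n w)
        (S₀ := ball T n u) (R := {u}) (R₁ := {u}) (R₂ := {u}) (R₀ := {u})
        (by
          intro x hx
          simp only [Finset.mem_union, Finset.biUnion_insert] at hx ⊢
          tauto)
        (by simp) Finset.subset_union_left Finset.subset_union_left le_rfl le_rfl
      rw [ha, hc n u w hadj] at h2
      rw [Finset.card_insert_of_notMem hw]
      push_cast
      linarith
  have := key _ le_rfl
  rwa [SimpleGraph.card_neighborFinset_eq_degree, hd u, ← ball, ha] at this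

/-- The two larger balls are attached in turn to the smaller edge ball, which lies in both. The
overlap keeps the second argument `{u}` or `{v}`, hence `c n`, used for both orientations of the
edge. -/
lemma edge_ball_succ_le (hG : IsSubmodular G)
    (ha : ∀ n u, G (ball T n u) {u} = a n)
    (hc : ∀ n u v, T.Adj u v → G (ball T n u ∪ ball T n v) {u} = c n) (n : ℕ) {u v : V}
    (h : T.Adj u v) :
    G (ball T (n + 1) u ∪ ball T (n + 1) v) {u, v} ≤
      G (ball T n u ∪ ball T n v) {u, v} + 2 * (a (n + 1) - c n) := by
  have hu : ball T n u ∪ ball T n v ⊆ ball T (n + 1) u :=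
    Finset.union_subset (ball_subset_succ n u) (ball_subset_succ_of_adj n h)
  have hv : ball T n u ∪ ball T n v ⊆ ball T (n + 1) v :=
    Finset.union_subset (ball_subset_succ_of_adj n h.symm) (ball_subset_succ n v)
  have h1 := hG (S := ball T (n + 1) u) (S₁ := ball T n u ∪ ball T n v) (S₂ := ball T (n + 1) u)
    (S₀ := ball T n u ∪ ball T n v) (R := {u, v}) (R₁ := {u, v}) (R₂ := {u}) (R₀ := {u})
    Finset.subset_union_right Finset.subset_union_left le_rfl hu (by simp) le_rfl
  have h2 := hG (S := ball T (n + 1) u ∪ ball T (n + 1) v) (S₁ := ball T (n + 1) u)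
    (S₂ := ball T (n + 1) v) (S₀ := ball T n u ∪ ball T n v) (R := {u, v}) (R₁ := {u, v})
    (R₂ := {v}) (R₀ := {v}) le_rfl Finset.subset_union_left hu hv (by simp) le_rfl
  rw [ha, hc n u v h] at h1
  have hc' := hc n v u h.symm
  rw [Finset.union_comm] at hc'
  rw [ha, hc'] at h2
  linarith

/-- The edge-vertex functional of an invariant submodular function does not increase when it is
refined from the bare edge to the `n`-balls around an edge, up to the entropy `h` of one label. -/
theorem edge_vertex_le (hG : IsSubmodular G) {d : ℕ} (hd : T.IsRegularOfDegree d)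
    (ha : ∀ n u, G (ball T n u) {u} = a n)
    (hc : ∀ n u v, T.Adj u v → G (ball T n u ∪ ball T n v) {u} = c n)
    {h p : ℝ} (hp : ∀ u, G ∅ {u} = p) (hh : ∀ u, G {u} ∅ ≤ h) (h0 : 0 ≤ G ∅ ∅)
    {u v : V} (huv : T.Adj u v) (n : ℕ) :
    (d : ℝ) / 2 * G (ball T n u ∪ ball T n v) {u, v} - (d - 1) * a n ≤
      d / 2 * G ∅ {u, v} - (d - 1) * p + h := by
  have hd0 : (0 : ℝ) ≤ d := Nat.cast_nonneg d
  induction n with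
  | zero =>
    -- The first two inequalities add the labels of `u` and `v` to the bare edge, at cost `a 0 - p`
    -- each; the third gives `a 0 ≤ p + h`.
    have h1 := hG (S := {u}) (S₁ := ∅) (S₂ := {u}) (S₀ := ∅) (R := {u, v}) (R₁ := {u, v})
      (R₂ := {u}) (R₀ := {u}) (by simp) Finset.subset_union_left le_rfl (by simp) (by simp) le_rfl
    have h2 := hG (S := {u, v}) (S₁ := {u}) (S₂ := {v}) (S₀ := ∅) (R := {u, v}) (R₁ := {u, v})
      (R₂ := {v}) (R₀ := {v}) le_rfl Finset.subset_union_left (by simp) (by simp) (by simp) le_rfl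
    have h3 := hG (S := {u}) (S₁ := {u}) (S₂ := ∅) (S₀ := ∅) (R := {u}) (R₁ := ∅)
      (R₂ := {u}) (R₀ := ∅) (by simp) (by simp) (by simp) le_rfl le_rfl (by simp)
    have hau := ha 0 u
    have hav := ha 0 v
    simp only [ball] at hau hav ⊢
    have hpair : ({u} ∪ {v} : Finset V) = {u, v} := rfl
    rw [hpair]
    rw [hau, hp] at h1 h3
    rw [hav, hp] at h2
    have hhu := hh u
    nlinarith
  | succ n ih =>
    have h1 := ball_succ_le hG hd ha hc n u
    have h2 := edge_ball_succ_le hG ha hc n huv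
    nlinarith

end Submodular

/-! ### Vanishing conditional entropy -/

section Approximation

open Filter Topology

variable {Ω : Type*} [mΩ : MeasurableSpace Ω] {μ : Measure Ω} [IsProbabilityMeasure μ]

lemma tendsto_rvEntropy {α : Type*} [Fintype α] {W : ℕ → Ω → α} {W' : Ω → α}
    (hW : ∀ n y, MeasurableSet (W n ⁻¹' {y})) (hW' : ∀ y, MeasurableSet (W' ⁻¹' {y}))
    (h : ∀ᵐ a ∂μ, ∀ᶠ n in atTop, W n a = W' a) :
    Tendsto (fun n => rvEntropy μ (W n)) atTop (𝓝 (rvEntropy μ W')) := by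
  refine tendsto_finsetSum _ fun y _ => (Real.continuous_negMulLog.tendsto _).comp ?_
  refine (ENNReal.tendsto_toReal (measure_ne_top μ _)).comp ?_
  refine tendsto_measure_of_ae_tendsto_indicator_of_isFiniteMeasure _ (hW' y) (fun n => hW n y) ?_
  filter_upwards [h] with a ha
  filter_upwards [ha] with n hn
  simp [hn]

lemma eq_of_measurable_comap {Ω α : Type*} [mα : MeasurableSpace α] {Y : Ω → α} {F : Ω → ℝ}
    (hF : Measurable[mα.comap Y] F) {a b : Ω} (h : Y a = Y b) : F a = F b := by
  obtain ⟨s, -, hs⟩ := MeasurableSpace.measurableSet_comap.1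
    (hF (measurableSet_singleton (F a)))
  have ha : a ∈ Y ⁻¹' s := by rw [hs]; rfl
  have hb : b ∈ F ⁻¹' {F a} := by rw [← hs]; change Y b ∈ s; rw [← h]; exact ha
  exact hb.symm

/-- The conditional entropy of a finite-valued random variable `Z` given an increasing sequence
of finite-valued random variables tends to `0` if these generate `Z`. -/
theorem tendsto_rvEntropy_prod_sub {χ : Type*} [Fintype χ] {α : ℕ → Type*} [∀ n, Fintype (α n)]
    [mα : ∀ n, MeasurableSpace (α n)] [∀ n, MeasurableSingletonClass (α n)] {Y : ∀ n, Ω → α n}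
    (ℱ : Filtration ℕ mΩ) (hℱ : ∀ n, ℱ n = (mα n).comap (Y n)) {Z : Ω → χ}
    (hZ : ∀ x, MeasurableSet[⨆ n, ℱ n] (Z ⁻¹' {x})) {ε : ℝ} (hε : 0 < ε) :
    ∀ᶠ n in atTop, rvEntropy μ (fun a => (Z a, Y n a)) ≤ rvEntropy μ (Y n) + ε := by
  classical
  have hZ' : ∀ x, MeasurableSet (Z ⁻¹' {x}) := fun x =>
    (iSup_le fun n => ℱ.le n : ⨆ n, ℱ n ≤ mΩ) _ (hZ x)
  have hY : ∀ n y, MeasurableSet (Y n ⁻¹' {y}) := fun n y =>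
    ℱ.le n _ (by rw [hℱ n]; exact ⟨{y}, measurableSet_singleton y, rfl⟩)
  let I : χ → Ω → ℝ := fun x => (Z ⁻¹' {x}).indicator fun _ => 1
  let M : ℕ → χ → Ω → ℝ := fun n x => μ[I x | ℱ n]
  have hM : ∀ n x, Measurable[ℱ n] (M n x) := fun n x => stronglyMeasurable_condExp.measurable
  have hlim : ∀ᵐ a ∂μ, ∀ x, Tendsto (fun n => M n x a) atTop (𝓝 (I x a)) := by
    rw [ae_all_iff]
    intro x
    refine Integrable.tendsto_ae_condExp ((integrable_const 1).indicator (hZ' x)) ?_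
    exact StronglyMeasurable.indicator stronglyMeasurable_const (hZ x)
  -- Rounding the conditional probabilities gives a guess of `Z` that depends only on `Y n` and is
  -- almost surely eventually correct. Its range does not grow with `n`, so its entropies converge.
  let g : ℕ → Ω → (χ → Bool) := fun n a x => decide (1 / 2 < M n x a)
  let g' : Ω → (χ → Bool) := fun a x => decide (Z a = x)
  have hg : ∀ n y, MeasurableSet (g n ⁻¹' {y}) := by
    intro n y
    have : g n ⁻¹' {y} = ⋂ x, {a | decide (1 / 2 < M n x a) = y x} := by
      ext a
      simp [g, funext_iff]
    rw [this]
    refine MeasurableSet.iInter fun x => ?_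
    have hm : MeasurableSet {a | 1 / 2 < M n x a} :=
      measurableSet_lt measurable_const ((hM n x).mono (ℱ.le n) le_rfl)
    cases y x
    · simpa [Set.compl_def] using hm.compl
    · simpa using hm
  have hg' : ∀ y, MeasurableSet (g' ⁻¹' {y}) := by
    intro y
    have : g' ⁻¹' {y} = ⋃ x ∈ {x | (fun x' => decide (x = x')) = y}, Z ⁻¹' {x} := by
      ext a
      simp [g']
    rw [this]
    exact MeasurableSet.biUnion (Set.to_countable _) fun x _ => hZ' x
  have hgg' : ∀ᵐ a ∂μ, ∀ᶠ n in atTop, g n a = g' a := by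
    filter_upwards [hlim] with a ha
    have : ∀ x, ∀ᶠ n in atTop, g n a x = g' a x := by
      intro x
      by_cases hx : Z a = x
      · have h1 : I x a = 1 := by simp [I, hx]
        have h2 := ha x
        rw [h1] at h2
        filter_upwards [h2.eventually (lt_mem_nhds (by norm_num : (1 / 2 : ℝ) < 1))] with n hn
        simp only [g, g', hx, decide_true, decide_eq_true_eq]
        exact hn
      · have h1 : I x a = 0 := by simp [I, hx]
        have h2 := ha x
        rw [h1] at h2
        filter_upwards [h2.eventually (gt_mem_nhds (by norm_num : (0 : ℝ) < 1 / 2))] with n hn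
        simp only [g, g', hx, decide_false, decide_eq_false_iff_not, not_lt]
        exact hn.le
    filter_upwards [eventually_all.2 this] with n hn
    exact funext hn
  have hgY : ∀ n a b, Y n a = Y n b → g n a = g n b := by
    intro n a b h
    funext x
    have : M n x a = M n x b := eq_of_measurable_comap (by rw [← hℱ n]; exact hM n x) h
    simp only [g, this]
  have h1 : Tendsto (fun n => rvEntropy μ (fun a => (Z a, g n a)) - rvEntropy μ (g n)) atTop
      (𝓝 (rvEntropy μ (fun a => (Z a, g' a)) - rvEntropy μ g')) := by
    refine (tendsto_rvEntropy (fun n => measurableSet_preimage_prod hZ' (hg n))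
      (measurableSet_preimage_prod hZ' hg') ?_).sub (tendsto_rvEntropy hg hg' hgg')
    filter_upwards [hgg'] with a ha
    filter_upwards [ha] with n hn
    rw [hn]
  have h2 : rvEntropy μ (fun a => (Z a, g' a)) = rvEntropy μ g' := by
    refine rvEntropy_eq (measurableSet_preimage_prod hZ' hg') hg' fun a b => ?_
    simp only [Prod.mk.injEq, and_iff_right_iff_imp]
    intro h
    have := congrFun h (Z b)
    simpa [g'] using this
  rw [h2, sub_self] at h1
  filter_upwards [h1.eventually (gt_mem_nhds hε)] with n hn
  -- Conditioning on `Y n` leaves no more entropy in `Z` than conditioning on its function `g n`.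
  have h3 := rvEntropy_submodular (μ := μ) (A := fun a => (Z a, g n a)) (B := Y n) (C := g n)
    (D := fun a => (Z a, Y n a)) (measurableSet_preimage_prod hZ' (hg n)) (hY n) (hg n)
    (fun a b h h' => by
      simp only [Prod.mk.injEq] at h ⊢
      exact ⟨h.1, h'⟩)
    (fun a b h => (Prod.mk.inj h).2) (hgY n)
  linarith

end Approximation

/-! ### Joint entropies of labels and factor values -/

section JointEntropy

open scoped Classical

variable {V χ A Ω : Type*}

/-- The values of `Q` on `S` together with the values of `Φ` on `R`. -/
def jointVar (Q : V → Ω → A) (Φ : V → Ω → χ) (S R : Finset V) (a : Ω) : (S → A) × (R → χ) :=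
  (fun v => Q v a, fun v => Φ v a)

lemma jointVar_eq_iff {Q : V → Ω → A} {Φ : V → Ω → χ} {S R : Finset V} {a b : Ω} :
    jointVar Q Φ S R a = jointVar Q Φ S R b ↔
      (∀ v ∈ S, Q v a = Q v b) ∧ ∀ v ∈ R, Φ v a = Φ v b := by
  simp [jointVar, funext_iff]

variable [MeasurableSpace Ω] {μ : Measure Ω} [MeasurableSpace χ] [MeasurableSpace A]

lemma measurable_jointVar {Q : V → Ω → A} {Φ : V → Ω → χ} (hQ : ∀ v, Measurable (Q v))
    (hΦ : ∀ v, Measurable (Φ v)) (S R : Finset V) : Measurable (jointVar Q Φ S R) :=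
  (measurable_pi_lambda _ fun v : S => hQ v).prodMk (measurable_pi_lambda _ fun v : R => hΦ v)

variable [Fintype χ] [DiscreteMeasurableSpace χ] [Fintype A] [DiscreteMeasurableSpace A]

lemma measurableSet_jointVar {Q : V → Ω → A} {Φ : V → Ω → χ} (hQ : ∀ v, Measurable (Q v))
    (hΦ : ∀ v, Measurable (Φ v)) (S R : Finset V) (y : (S → A) × (R → χ)) :
    MeasurableSet (jointVar Q Φ S R ⁻¹' {y}) :=
  measurable_jointVar hQ hΦ S R (measurableSet_singleton y)

lemma measurable_act {L : Type*} [MeasurableSpace L] {T : SimpleGraph V} (γ : T ≃g T) :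
    Measurable (act γ : (V → L) → V → L) :=
  measurable_pi_lambda _ fun v => measurable_pi_apply (γ.symm v)

lemma rvEntropy_comp_eq_of_map_eq {α E : Type*} [Fintype α] [MeasurableSpace α]
    [MeasurableSingletonClass α] [MeasurableSpace E] {Y Y' : Ω → E} (hY : Measurable Y)
    (hY' : Measurable Y') (h : μ.map Y = μ.map Y') {g : E → α} (hg : Measurable g) :
    rvEntropy μ (g ∘ Y) = rvEntropy μ (g ∘ Y') := by
  rw [← entropy_map μ (hg.comp hY), ← entropy_map μ (hg.comp hY'), ← Measure.map_map hg hY,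
    ← Measure.map_map hg hY', h]

variable {X : V → Ω → unitInterval}

/-- Permuting iid labels preserves their law: both sides are the product of uniform measures. -/
lemma IsRandomLabelling.map_act (hX : IsRandomLabelling μ X) {T : SimpleGraph V} (γ : T ≃g T) :
    μ.map (fun a => act γ fun v => X v a) = μ.map (fun a v => X v a) := by
  have h2 := (hX.indep.precomp γ.symm.injective).map_fun_eq_infinitePi_map
    (fun v => hX.measurable _)
  have h1 := hX.indep.map_fun_eq_infinitePi_map hX.measurable
  refine h2.trans ?_
  rw [h1]
  simp only [hX.uniform]

lemma rvEntropy_comp_of_uniform {Y : Ω → unitInterval} (hY : Measurable Y)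
    (h : μ.map Y = (volume : Measure unitInterval)) {q : unitInterval → A} (hq : Measurable q) :
    rvEntropy μ (q ∘ Y) = entropy ((volume : Measure unitInterval).map q) := by
  rw [← entropy_map μ (hq.comp hY), ← Measure.map_map hq hY, h]

variable [IsProbabilityMeasure μ]

lemma isSubmodular_rvEntropy {Q : V → Ω → A} {Φ : V → Ω → χ} (hQ : ∀ v, Measurable (Q v))
    (hΦ : ∀ v, Measurable (Φ v)) :
    IsSubmodular fun S R => rvEntropy μ (jointVar Q Φ S R) := by
  intro S S₁ S₂ S₀ R R₁ R₂ R₀ hS hR hS₁ hS₂ hR₁ hR₂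
  refine rvEntropy_submodular (measurableSet_jointVar hQ hΦ _ _) (measurableSet_jointVar hQ hΦ _ _)
    (measurableSet_jointVar hQ hΦ _ _) (fun a b h h' => ?_) (fun a b h => ?_) (fun a b h => ?_)
  · rw [jointVar_eq_iff] at *
    exact ⟨fun v hv => (Finset.mem_union.1 (hS hv)).elim (h.1 v) (h'.1 v),
      fun v hv => (Finset.mem_union.1 (hR hv)).elim (h.2 v) (h'.2 v)⟩
  · rw [jointVar_eq_iff] at *
    exact ⟨fun v hv => h.1 v (hS₁ hv), fun v hv => h.2 v (hR₁ hv)⟩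
  · rw [jointVar_eq_iff] at *
    exact ⟨fun v hv => h.1 v (hS₂ hv), fun v hv => h.2 v (hR₂ hv)⟩

/-- The joint entropies of the labels and of a factor are invariant under automorphisms. -/
lemma rvEntropy_jointVar_image (hX : IsRandomLabelling μ X) {T : SimpleGraph V} {o : V}
    {f : (V → unitInterval) → χ} (hf : Measurable f) {Φ : V → Ω → χ}
    (hΦm : ∀ v, Measurable (Φ v))
    (hΦ : ∀ (v : V) (γ : T ≃g T), γ v = o → ∀ a : Ω, Φ v a = f (act γ (fun u => X u a)))
    (htrans : ∀ v, ∃ γ : T ≃g T, γ v = o) {q : unitInterval → A} (hq : Measurable q)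
    (γ : T ≃g T) (S R : Finset V) :
    rvEntropy μ (jointVar (fun v => q ∘ X v) Φ (S.image γ) (R.image γ)) =
      rvEntropy μ (jointVar (fun v => q ∘ X v) Φ S R) := by
  choose δ hδ using htrans
  let g : (V → unitInterval) → (S.image γ → A) × (R.image γ → χ) :=
    fun ω => (fun v => q (ω v), fun v => f (act (δ v) ω))
  have hg : Measurable g :=
    (measurable_pi_lambda _ fun v : S.image γ => hq.comp (measurable_pi_apply (v : V))).prodMk
      (measurable_pi_lambda _ fun v : R.image γ => hf.comp (measurable_act (δ v)))
  have hXm : Measurable fun a v => X v a := measurable_pi_lambda _ hX.measurable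
  have hX' : Measurable fun a => act γ fun v => X v a := (measurable_act γ).comp hXm
  have h1 : jointVar (fun v => q ∘ X v) Φ (S.image γ) (R.image γ) = g ∘ fun a v => X v a := by
    funext a
    refine Prod.ext rfl (funext fun v => ?_)
    exact hΦ v (δ v) (hδ v) a
  rw [h1, ← rvEntropy_comp_eq_of_map_eq hX' hXm (hX.map_act γ) hg]
  refine rvEntropy_eq (fun y => hg.comp hX' (measurableSet_singleton y))
    (measurableSet_jointVar (fun v => hq.comp (hX.measurable v)) hΦm _ _) fun a b => ?_
  -- The automorphism `γ` followed by `δ (γ v)` takes `v` to the root, so it may be used to compute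
  -- `Φ v`.
  have h2 : ∀ v a, f (act (δ (γ v)) (act γ fun u => X u a)) = Φ v a := fun v a =>
    (hΦ v (γ.trans (δ (γ v))) (hδ (γ v)) a).symm
  rw [jointVar_eq_iff]
  simp [g, funext_iff, act, ← h2]

/-- The entropy of finitely many discretized labels. -/
lemma rvEntropy_labels (hX : IsRandomLabelling μ X) {Φ : V → Ω → χ} (hΦm : ∀ v, Measurable (Φ v))
    {q : unitInterval → A} (hq : Measurable q) (S : Finset V) :
    rvEntropy μ (jointVar (fun v => q ∘ X v) Φ S ∅) =
      S.card * entropy ((volume : Measure unitInterval).map q) := by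
  have hQ : ∀ v, Measurable (q ∘ X v) := fun v => hq.comp (hX.measurable v)
  have hind : iIndepFun (fun v => q ∘ X v) μ := hX.indep.comp (fun _ => q) fun _ => hq
  have hJ : ∀ S : Finset V, rvEntropy μ (jointVar (fun v => q ∘ X v) Φ S ∅) =
      rvEntropy μ (fun a (v : S) => (q ∘ X v) a) := fun S =>
    rvEntropy_eq (measurableSet_jointVar hQ hΦm _ _)
      (fun y => measurable_pi_lambda _ (fun v : S => hQ v) (measurableSet_singleton y))
      fun a b => by simp [jointVar_eq_iff, funext_iff]
  rw [hJ]
  induction S using Finset.induction_on with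
  | empty =>
    rw [Finset.card_empty, Nat.cast_zero, zero_mul]
    refine Finset.sum_eq_zero fun y _ => ?_
    rw [Set.eq_univ_of_forall (s := (fun a (v : (∅ : Finset V)) => (q ∘ X v) a) ⁻¹' {y})
      fun a => Subsingleton.elim _ _, probReal_univ, Real.negMulLog_one]
  | insert v S hv ih =>
    have h1 : IndepFun (fun a (i : S) => (q ∘ X i) a) (q ∘ X v) μ := by
      have h := hind.indepFun_finset S {v} (Finset.disjoint_singleton_right.2 hv) hQ
      exact h.comp measurable_id
        (measurable_pi_apply (⟨v, Finset.mem_singleton_self v⟩ : ({v} : Finset V)))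
    have hS : Measurable fun a (i : S) => (q ∘ X i) a := measurable_pi_lambda _ fun i => hQ i
    have h2 : rvEntropy μ (fun a => ((fun i : S => (q ∘ X i) a), (q ∘ X v) a)) =
        rvEntropy μ (fun a (i : S) => (q ∘ X i) a) + rvEntropy μ (q ∘ X v) := by
      refine rvEntropy_prod_of_indep (fun y => hS (measurableSet_singleton y))
        (fun y => hQ v (measurableSet_singleton y)) fun x y => ?_
      simp only [measureReal_def, ← ENNReal.toReal_mul]
      rw [h1.measure_inter_preimage_eq_mul _ _ (measurableSet_singleton x)
        (measurableSet_singleton y)]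
    have h3 : rvEntropy μ (fun a (i : (insert v S : Finset V)) => (q ∘ X i) a) =
        rvEntropy μ (fun a => ((fun i : S => (q ∘ X i) a), (q ∘ X v) a)) := by
      refine rvEntropy_eq
        (fun y => measurable_pi_lambda _ (fun i : (insert v S : Finset V) => hQ i)
          (measurableSet_singleton y))
        (fun y => (hS.prodMk (hQ v)) (measurableSet_singleton y)) fun a b => ?_
      simp [funext_iff, and_comm]
    rw [h3, h2, ih, rvEntropy_comp_of_uniform (hX.measurable v) (hX.uniform v) hq,
      Finset.card_insert_of_notMem hv]
    push_cast
    ring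

end JointEntropy

/-! ### Discretization of the labels -/

section Quantization

open MeasurableSpace (natGeneratingSequence)

/-- The first `n` bits of a point of `[0,1]`, with respect to a countable generating family. -/
noncomputable def quantize (n : ℕ) (x : unitInterval) (i : Fin n) : Bool :=
  open scoped Classical in decide (x ∈ natGeneratingSequence unitInterval i)

lemma measurable_quantize (n : ℕ) : Measurable (quantize n) := by
  classical
  refine measurable_pi_lambda _ fun i => ?_
  refine measurable_to_bool ?_
  have : (fun x => quantize n x i) ⁻¹' {true} = natGeneratingSequence unitInterval i := by
    ext x; simp [quantize]
  rw [this]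
  exact MeasurableSpace.measurableSet_natGeneratingSequence _

variable {V Ω : Type*} {X : V → Ω → unitInterval}

/-- The first `n` bits of the labels in the `n`-th set of an increasing sequence of finite sets. -/
noncomputable def quantizedLabels (X : V → Ω → unitInterval) (B : ℕ → Finset V) (n : ℕ) (a : Ω)
    (v : B n) : Fin n → Bool :=
  quantize n (X v a)

variable [mΩ : MeasurableSpace Ω]

lemma measurable_quantizedLabels (hX : ∀ v, Measurable (X v)) (B : ℕ → Finset V) (n : ℕ) :
    Measurable (quantizedLabels X B n) :=
  measurable_pi_lambda _ fun v => (measurable_quantize n).comp (hX v)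

/-- The filtration generated by the quantized labels. -/
noncomputable def quantizedFiltration (hX : ∀ v, Measurable (X v)) {B : ℕ → Finset V}
    (hB : Monotone B) : Filtration ℕ mΩ where
  seq n := MeasurableSpace.comap (quantizedLabels X B n) inferInstance
  mono' := by
    intro m n hmn
    let g : (B n → Fin n → Bool) → B m → Fin m → Bool :=
      fun w v i => w ⟨v, hB hmn v.2⟩ (Fin.castLE hmn i)
    have hg : Measurable g :=
      measurable_pi_lambda _ fun v => measurable_pi_lambda _ fun i =>
        (measurable_pi_apply (Fin.castLE hmn i)).comp
          (measurable_pi_apply (⟨v, hB hmn v.2⟩ : B n))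
    change MeasurableSpace.comap (g ∘ quantizedLabels X B n) _ ≤ _
    rw [← MeasurableSpace.comap_comp]
    exact MeasurableSpace.comap_mono hg.comap_le
  le' n := (measurable_quantizedLabels hX B n).comap_le

/-- The quantized labels generate all the labels. -/
lemma measurable_label_iSup (hX : ∀ v, Measurable (X v)) {B : ℕ → Finset V} (hB : Monotone B)
    (hcover : ∀ v, ∃ n, v ∈ B n) (v : V) :
    Measurable[⨆ n, quantizedFiltration hX hB n] (X v) := by
  classical
  have hgen := MeasurableSpace.generateFrom_natGeneratingSequence unitInterval
  have key : ∀ i, MeasurableSet[⨆ n, quantizedFiltration hX hB n]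
      (X v ⁻¹' natGeneratingSequence unitInterval i) := by
    intro i
    obtain ⟨m, hm⟩ := hcover v
    -- At this stage `v` lies in `B n` and bit `i` of its label is recorded.
    let n := max m (i + 1)
    have hv : v ∈ B n := hB (le_max_left _ _) hm
    have hi : i < n := lt_of_lt_of_le (Nat.lt_succ_self i) (le_max_right _ _)
    refine le_iSup (fun n => (quantizedFiltration hX hB n : MeasurableSpace Ω)) n _ ?_
    refine ⟨{w | w ⟨v, hv⟩ ⟨i, hi⟩ = true}, ?_, ?_⟩
    · have hev : Measurable fun w : B n → Fin n → Bool => w ⟨v, hv⟩ ⟨i, hi⟩ :=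
        (measurable_pi_apply (⟨i, hi⟩ : Fin n)).comp (measurable_pi_apply (⟨v, hv⟩ : B n))
      exact hev (measurableSet_singleton true)
    · ext a
      simp [quantizedLabels, quantize]
  intro s hs
  rw [← hgen] at hs
  exact MeasurableSpace.generateFrom_le
    (m := (⨆ n, (quantizedFiltration hX hB n : MeasurableSpace Ω)).map (X v))
    (by rintro _ ⟨i, rfl⟩; exact key i) s hs

end Quantization

end FIID

/-! ### The edge-vertex inequality -/

theorem theorem4 {V χ Ω : Type*}
    -- `T` is the `d`-regular tree, rooted at `o`
    (d : ℕ) (T : SimpleGraph V) [T.LocallyFinite] (hT : T.IsTree)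
    (hd : T.IsRegularOfDegree d) (o : V)
    -- the finite set of colours
    [Fintype χ] [MeasurableSpace χ] [DiscreteMeasurableSpace χ]
    [MeasurableSpace Ω] (μ : Measure Ω) [IsProbabilityMeasure μ]
    (Φ : V → Ω → χ) (hΦ : FIID.IsFIID T o μ Φ)
    -- a directed edge
    (u v : V) (huv : T.Adj u v) :
    0 ≤ (d : ℝ) / 2 * FIID.entropy (μ.map (fun a => (Φ u a, Φ v a)))
        - ((d : ℝ) - 1) * FIID.entropy (μ.map (Φ o)) := by
  open FIID in
  classical
  obtain ⟨X, f, hX, hf, hΦf⟩ := hΦ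
  have hnbr : ∀ x, ∃ y, T.Adj x y := by
    intro x
    rw [← T.degree_pos_iff_exists_adj, hd x, ← hd u, T.degree_pos_iff_exists_adj]
    exact ⟨v, huv⟩
  have harc : ∀ x y, ∃ γ : T ≃g T, γ x = y := by
    intro x y
    obtain ⟨x', hx⟩ := hnbr x
    obtain ⟨y', hy⟩ := hnbr y
    obtain ⟨γ, h, -⟩ := exists_iso_of_adj hT hd hx hy
    exact ⟨γ, h⟩
  have hΦm : ∀ x, Measurable (Φ x) := by
    intro x
    obtain ⟨γ, hγ⟩ := harc x o
    rw [funext (hΦf x γ hγ)]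
    exact hf.measurable.comp ((measurable_act γ).comp (measurable_pi_lambda _ hX.measurable))
  let G : ℕ → Finset V → Finset V → ℝ := fun n S R =>
    rvEntropy μ (jointVar (fun x => quantize n ∘ X x) Φ S R)
  have hQ : ∀ n x, Measurable (quantize n ∘ X x) := fun n x =>
    (measurable_quantize n).comp (hX.measurable x)
  have hinv : ∀ n (γ : T ≃g T) S R, G n (S.image γ) (R.image γ) = G n S R := fun n γ S R =>
    rvEntropy_jointVar_image hX hf.measurable hΦm hΦf (fun x => harc x o) (measurable_quantize n)
      γ S R
  let B : ℕ → Finset V := fun n => ball T n o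
  have hB : Monotone B := ball_mono o
  -- Here `n` is both the number of bits and the radius, so the recorded labels form one filtration
  -- that exhausts all labels.
  have hlim : ∀ ε > 0, ∃ n, G n (B n) {o} ≤ G n (B n) ∅ + ε := by
    intro ε hε
    have hmeas : ∀ x, MeasurableSet[⨆ n, quantizedFiltration hX.measurable hB n]
        (Φ o ⁻¹' {x}) := by
      intro x
      have hXm : ∀ w, Measurable[⨆ n, quantizedFiltration hX.measurable hB n] (X w) :=
        measurable_label_iSup hX.measurable hB fun w => ⟨T.dist w o, (mem_ball hT).2 le_rfl⟩
      obtain ⟨γ, hγ⟩ := harc o o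
      rw [funext (hΦf o γ hγ)]
      exact (hf.measurable.comp ((measurable_act γ).comp 
        (@measurable_pi_lambda _ _ _ (_) _ _ hXm)))
        (measurableSet_singleton x)
    obtain ⟨n, hn⟩ := (tendsto_rvEntropy_prod_sub (μ := μ)
      (quantizedFiltration hX.measurable hB) (Y := quantizedLabels X B) (fun n => rfl)
      hmeas hε).exists
    refine ⟨n, ?_⟩
    have hY : ∀ y, MeasurableSet (quantizedLabels X B n ⁻¹' {y}) := fun y =>
      measurable_quantizedLabels hX.measurable B n (measurableSet_singleton y)
    have h1 : G n (B n) {o} = rvEntropy μ (fun a => (Φ o a, quantizedLabels X B n a)) :=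
      rvEntropy_eq (measurableSet_jointVar (hQ n) hΦm _ _)
        (measurableSet_preimage_prod (fun y => hΦm o (measurableSet_singleton y)) hY)
        fun a b => by
          rw [jointVar_eq_iff]
          simp [quantizedLabels, funext_iff, and_comm]
    have h2 : G n (B n) ∅ = rvEntropy μ (quantizedLabels X B n) :=
      rvEntropy_eq (measurableSet_jointVar (hQ n) hΦm _ _) hY fun a b => by
        rw [jointVar_eq_iff]
        simp [quantizedLabels, funext_iff]
    rw [h1, h2]
    exact hn
  have hvertex : ∀ n, G n ∅ {o} = entropy (μ.map (Φ o)) := by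
    intro n
    rw [entropy_map μ (hΦm o)]
    exact rvEntropy_eq (measurableSet_jointVar (hQ n) hΦm _ _)
      (fun y => hΦm o (measurableSet_singleton y)) fun a b => by simp [jointVar_eq_iff]
  have hedge : ∀ n, G n ∅ {u, v} = entropy (μ.map fun a => (Φ u a, Φ v a)) := by
    intro n
    rw [entropy_map μ ((hΦm u).prodMk (hΦm v))]
    exact rvEntropy_eq (measurableSet_jointVar (hQ n) hΦm _ _)
      (fun y => ((hΦm u).prodMk (hΦm v)) (measurableSet_singleton y))
      fun a b => by simp [jointVar_eq_iff]
  have hd1 : (1 : ℝ) ≤ d := by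
    have : 0 < d := by rw [← hd u]; exact (T.degree_pos_iff_exists_adj u).2 ⟨v, huv⟩
    exact_mod_cast this
  have hmain : ∀ n, -((d - 1) * (G n (B n) {o} - G n (B n) ∅)) ≤
      (d : ℝ) / 2 * entropy (μ.map (fun a => (Φ u a, Φ v a)))
        - ((d : ℝ) - 1) * entropy (μ.map (Φ o)) := by
    intro n
    set h := entropy ((volume : Measure unitInterval).map (quantize n))
    have hG : IsSubmodular (G n) := isSubmodular_rvEntropy (hQ n) hΦm
    have hlab : ∀ S : Finset V, G n S ∅ = S.card * h := fun S =>
      rvEntropy_labels hX hΦm (measurable_quantize n) S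
    have hvert : ∀ m x, G n (ball T m x) {x} = G n (ball T m o) {o} := by
      intro m x
      obtain ⟨γ, hγ⟩ := harc o x
      rw [← hinv n γ (ball T m o), image_ball, Finset.image_singleton, hγ]
    have harcs : ∀ m x y, T.Adj x y → G n (ball T m x ∪ ball T m y) {x} =
        G n (ball T m u ∪ ball T m v) {u} := by
      intro m x y hxy
      obtain ⟨γ, hγ, hγ'⟩ := exists_iso_of_adj hT hd huv hxy
      rw [← hinv n γ (ball T m u ∪ ball T m v), Finset.image_union, image_ball, image_ball,
        Finset.image_singleton, hγ, hγ']
    have hone : ∀ x, G n ∅ {x} = G n ∅ {o} := by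
      intro x
      obtain ⟨γ, hγ⟩ := harc o x
      rw [← hinv n γ ∅ {o}, Finset.image_singleton, hγ, Finset.image_empty]
    -- The discretization stays at `n` bits while the radius `m` varies; only the conclusion takes
    -- radius `n`.
    have key := edge_vertex_le hG hd (a := fun m => G n (ball T m o) {o})
      (c := fun m => G n (ball T m u ∪ ball T m v) {u}) hvert harcs hone
      (h := h) (fun x => by simp [hlab]) (by simp [hlab]) huv n
    rw [hvertex, hedge] at key
    have h1 := hG.mono (le_refl (ball T n u ∪ ball T n v)) (Finset.empty_subset {u, v})
    have h2 := hlab (B n)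
    rw [hlab, (card_ball hT hd n).2 u v huv] at h1
    rw [(card_ball hT hd n).1 o] at h2
    have h3 := ballCard_identity d n
    have h4 : (d : ℝ) / 2 * ((ballCard d n).2 * h) - (d - 1) * ((ballCard d n).1 * h) = h := by
      linear_combination h * h3
    have h5 := mul_le_mul_of_nonneg_left h1 (by positivity : (0 : ℝ) ≤ d / 2)
    rw [h2]
    linarith
  refine le_of_forall_pos_le_add fun ε hε => ?_
  have hd0 : (0 : ℝ) < d := by linarith
  -- Dividing by `d` rather than `d - 1` also covers `d = 1`.
  obtain ⟨n, hn⟩ := hlim (ε / d) (by positivity)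
  have h1 := hmain n
  have h2 : (d - 1) * (G n (B n) {o} - G n (B n) ∅) ≤ ε := by
    have h3 : (d - 1) * (G n (B n) {o} - G n (B n) ∅) ≤ (d - 1) * (ε / d) :=
      mul_le_mul_of_nonneg_left (by linarith) (by linarith)
    have h4 : (d - 1) * (ε / d) ≤ ε := by
      rw [← mul_div_assoc, div_le_iff₀ hd0]
      nlinarith
    linarith
  linarith
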